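/- **Theorem 3 (variational risk bound for Type I strongly super-Gaussian likelihoods, $\alpha$-Rényi divergence).** Let $h:[0,\infty)\to\mathbb R$ be convex, decreasing and three times continuously differentiable on $(0,\infty)$, such that $t\mapsto h(t^2)$ is Lipschitz and $\int_{\mathbb R}|s|^k e^{h(s^2)}\,ds<\infty$ for $k=1,\dots,4$; put $Z_h=\int_{\mathbb R} e^{h(s^2)}ds$. Let $n,p\ge 1$ and let $\mathbf X$ be an $n\times p$ real matrix with rows $\mathbf x_i^\top$. For $\theta=(\beta,\tau^2)\in\Theta=\mathbb R^p\times(0,\infty)$ let $$p(y\mid\mathbf X,\theta)=\prod_{i=1}^n \frac{\tau}{Z_h}\exp\{h(\tau^2(y_i-\mathbf x_i^\top\beta)^2)\},\qquad y\in\mathbb R^n,$$ and let $\mathbb P_{\theta_0}$ be the law of $y$ under a true parameter $\theta_0\in\Theta$. Let $\pi$ be the Normal-Gamma prior density on $\Theta$: $\beta\mid\tau^2\sim\mathcal N_p(\mu,\Sigma/\tau^2)$ and $\tau^2\sim\mathrm{Gamma}(a/2,b/2)$ (shape, rate), where $\mu\in\mathbb R^p$, $\Sigma$ is positive definite and $a,b>0$.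 For $\alpha\in(0,1)$ and $\xi\in[0,\infty)^n$ (with $\xi_i>0$ if $h'(0+)=-\infty$) let $$\varphi_\alpha(y\mid\mathbf X,\theta,\xi)=\Big\{\prod_{i=1}^n \frac{\tau}{Z_h}\exp\{h'(\xi_i^2)\,\tau^2(y_i-\mathbf x_i^\top\beta)^2+h(\xi_i^2)-\xi_i^2h'(\xi_i^2)\}\Big\}^\alpha$$ be the fractional tangent minorizer of the likelihood, let $\pi_\alpha(\theta\mid\mathcal D_n,\xi)\propto\varphi_\alpha(y\mid\mathbf X,\theta,\xi)\,\pi(\theta)$ be the variational posterior density on $\Theta$ given the data $\mathcal D_n=(\mathbf X,y)$, and let $\xi^\star$ be any maximizer over such $\xi$ of the evidence lower bound $$\mathsf L(\xi)=\int_\Theta\log\frac{\varphi_\alpha(y\mid\mathbf X,\theta,\xi)\,\pi(\theta)}{\pi_\alpha(\theta\mid\mathcal D_n,\xi)}\,\pi_\alpha(\theta\mid\mathcal D_n,\xi)\,d\theta .$$ Finally let $D_\alpha(\theta,\theta_0)=\frac{1}{n(\alpha-1)}\log\int p(y\mid\mathbf X,\theta)^{\alpha}\,p(y\mid\mathbf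 X,\theta_0)^{1-\alpha}\,dy$ be the $\alpha$-Rényi divergence per observation. For every $p$, $h$, $(\mu,\Sigma,a,b)$, $\theta_0$ and every bound $B$ on the Euclidean norms $\|\mathbf x_i\|_2$ of the rows there is a constant $C_1>0$ (depending on nothing else; in particular on $\mathbf X$ only through $p$ and $B$) such that the following holds for all $n\ge1$ and all $\mathbf X$ with $\max_i\|\mathbf x_i\|_2\le B$. (a) For all $\varepsilon_n\in(0,\frac14)$, $\alpha\in(0,1)$ and $D>1$, with $\mathbb P_{\theta_0}$-probability at least $1-4\varepsilon_n-[(D-1)^2n\varepsilon_n^2]^{-1}$, the function $D_\alpha(\cdot,\theta_0)$ is integrable with respect to $\pi_\alpha(\cdot\mid\mathcal D_n,\xi^\star)$ and $$(1-\alpha)\int_\Theta D_\alpha(\theta,\theta_0)\,\pi_\alpha(\theta\mid\mathcal D_n,\xi^\star)\,d\theta\le D\alpha\varepsilon_n^2+\frac{p\log p}{n}+C_1\frac pn\log\Big(\frac1{\varepsilon_n}\Big).$$ (b) Consequently, if $\varepsilon_n^2\asymp p\log n/n$, the bound is of order $p/n$ up to a logarithmic factor: for all $c_1,c_2>0$ and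 $D>1$ there is $C_2>0$, not depending on $n$, $\mathbf X$, $\varepsilon_n$ or $\alpha$, such that for $n\ge2$ and $\varepsilon_n\in(0,\frac14)$ with $c_1\,p\log n/n\le\varepsilon_n^2\le c_2\,p\log n/n$, with $\mathbb P_{\theta_0}$-probability at least $1-4\varepsilon_n-[(D-1)^2n\varepsilon_n^2]^{-1}$, the left-hand side in (a) is at most $C_2\,p\log n/n$. -/

import Mathlib

open Real Set MeasureTheory ProbabilityTheory Matrix
open scoped NNReal ENNReal

namespace SSG

/-- Parameters `θ = (β, τ²)`; the second component is the squared scale `τ²`. -/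
abbrev Param (p : ℕ) : Type := (Fin p → ℝ) × ℝ

/-- The parameter space `Θ = ℝ^p × (0, ∞)`. -/
def Theta (p : ℕ) : Set (Param p) := {θ | 0 < θ.2}

/-- The standing requirements on the function `h : [0, ∞) → ℝ` of a Type I strongly super-Gaussian
likelihood (only the values of `h` on `[0, ∞)` matter). -/
structure TypeI (h : ℝ → ℝ) : Prop where
  /-- `h` is convex. -/
  convex : ConvexOn ℝ (Ici 0) h
  /-- `h` is decreasing. -/
  decreasing : AntitoneOn h (Ici 0)
  /-- `h` is three times continuously differentiable on `(0, ∞)`. The one-sided derivatives at `0`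
  are allowed to be infinite, so that the Laplace family `h t = -√t` is covered. -/
  smooth : ContDiffOn ℝ 3 h (Ioi 0)
  /-- `t ↦ h (t ^ 2)` is `K`-Lipschitz for some `K` (so `h` is continuous on `[0, ∞)`). -/
  lipschitz : ∃ K : ℝ≥0, LipschitzWith K (fun t : ℝ => h (t ^ 2))
  /-- The error density proportional to `exp (h (s ^ 2))` has finite moments of orders
  `1, 2, 3, 4`. -/
  moments : ∀ k ∈ Finset.Icc 1 4, Integrable (fun s : ℝ => |s| ^ k * exp (h (s ^ 2)))

/-- The normalizing constant of the error density. -/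
noncomputable def normConst (h : ℝ → ℝ) : ℝ := ∫ s : ℝ, exp (h (s ^ 2))

/-- The likelihood of one observation:
`p(y | x, θ) = τ exp {h (τ² (y - xᵀβ)²)} / Z_h`. -/
noncomputable def lik1 (h : ℝ → ℝ) {p : ℕ} (x : Fin p → ℝ) (θ : Param p) (y : ℝ) : ℝ :=
  (normConst h)⁻¹ * √θ.2 * exp (h (θ.2 * (y - x ⬝ᵥ θ.1) ^ 2))

/-- The likelihood of the response vector, `p(y | X, θ) = ∏ᵢ p(yᵢ | xᵢ, θ)`. -/
noncomputable def lik (h : ℝ → ℝ) {n p : ℕ} (X : Matrix (Fin n) (Fin p) ℝ) (θ : Param p)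
    (y : Fin n → ℝ) : ℝ :=
  ∏ i, lik1 h (X i) θ (y i)

/-- The law `ℙ_θ` of the response vector. -/
noncomputable def dataLaw (h : ℝ → ℝ) {n p : ℕ} (X : Matrix (Fin n) (Fin p) ℝ) (θ : Param p) :
    Measure (Fin n → ℝ) :=
  volume.withDensity (fun y => ENNReal.ofReal (lik h X θ y))

/-- `A(t) = h'(t²)`. -/
noncomputable def tangentSlope (h : ℝ → ℝ) (t : ℝ) : ℝ := derivWithin h (Ici 0) (t ^ 2)

/-- `γ(t) = h(t²) - t² h'(t²)`. -/
noncomputable def tangentIntercept (h : ℝ → ℝ) (t : ℝ) : ℝ := h (t ^ 2) - t ^ 2 * tangentSlope h t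

/-- The variational parameters: the vectors `ξ ∈ [0, ∞)ⁿ` at which the tangents exist. This is all
of `[0, ∞)ⁿ` if `h` has a finite right derivative at `0`, and `(0, ∞)ⁿ` if `h'(0+) = -∞`, where there
is no tangent line at `ξᵢ = 0`. -/
def varParams (h : ℝ → ℝ) (n : ℕ) : Set (Fin n → ℝ) :=
  {ξ | ∀ i, 0 ≤ ξ i ∧ DifferentiableWithinAt ℝ h (Ici 0) (ξ i ^ 2)}

/-- The tangent minorizer `φ(y | x, θ, ξ)` of the likelihood of one observation. -/
noncomputable def tangent1 (h : ℝ → ℝ) {p : ℕ} (x : Fin p → ℝ) (θ : Param p) (ξ y : ℝ) : ℝ :=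
  (normConst h)⁻¹ * √θ.2 * exp (tangentSlope h ξ * (θ.2 * (y - x ⬝ᵥ θ.1) ^ 2) + tangentIntercept h ξ)

/-- The `α`-fractional tangent minorizer `φ_α(y | X, θ, ξ) = {∏ᵢ φ(yᵢ | xᵢ, θ, ξᵢ)}^α`. -/
noncomputable def fracTangent (h : ℝ → ℝ) (α : ℝ) {n p : ℕ} (X : Matrix (Fin n) (Fin p) ℝ)
    (y ξ : Fin n → ℝ) (θ : Param p) : ℝ :=
  (∏ i, tangent1 h (X i) θ (ξ i) (y i)) ^ α

/-- The density on `Θ` of the Normal-Gamma distribution `NG_p(μ, S, a, b)`: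
`β | τ² ~ N_p(μ, S / τ²)` and `τ² ~ Gamma(a / 2, b / 2)` (shape and rate). -/
noncomputable def normalGamma {p : ℕ} (μ : Fin p → ℝ) (S : Matrix (Fin p) (Fin p) ℝ) (a b : ℝ)
    (θ : Param p) : ℝ :=
  (√(((2 * π / θ.2) • S).det))⁻¹ * exp (-(θ.2 / 2) * ((θ.1 - μ) ⬝ᵥ (S⁻¹ *ᵥ (θ.1 - μ))))
    * gammaPDFReal (a / 2) (b / 2) θ.2

section Variational

variable (h : ℝ → ℝ) (α : ℝ) {n p : ℕ} (X : Matrix (Fin n) (Fin p) ℝ) (prior : Param p → ℝ)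
  (y : Fin n → ℝ)

/-- The normalizing constant `φ_α(y | X, ξ) = ∫_Θ φ_α(y | X, θ, ξ) π(θ) dθ`. -/
noncomputable def evidence (ξ : Fin n → ℝ) : ℝ :=
  ∫ θ in Theta p, fracTangent h α X y ξ θ * prior θ

/-- The density of the `α`-fractional variational posterior `π_α(θ | 𝒟ₙ, ξ)`. -/
noncomputable def varPosterior (ξ : Fin n → ℝ) (θ : Param p) : ℝ :=
  fracTangent h α X y ξ θ * prior θ / evidence h α X prior y ξ

/-- The evidence lower bound `ℒ(q, ξ)` of a density `q` on `Θ`. -/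
noncomputable def elbo (q : Param p → ℝ) (ξ : Fin n → ℝ) : ℝ :=
  ∫ θ in Theta p, log (fracTangent h α X y ξ θ * prior θ / q θ) * q θ

/-- The profile objective `L(ξ) = ℒ(π_α(· | 𝒟ₙ, ξ), ξ)`. -/
noncomputable def profileElbo (ξ : Fin n → ℝ) : ℝ :=
  elbo h α X prior y (varPosterior h α X prior y ξ) ξ

/-- `ξ` is an optimal variational parameter: it maximizes `L` over the variational parameters. -/
def IsOptimal (ξ : Fin n → ℝ) : Prop :=
  ξ ∈ varParams h n ∧
    ∀ ξ' ∈ varParams h n, profileElbo h α X prior y ξ' ≤ profileElbo h α X prior y ξ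

end Variational

/-- The `α`-Rényi divergence per observation,
`D_α(θ, θ₀) = (n (α - 1))⁻¹ log ∫ p(y | X, θ)^α p(y | X, θ₀)^(1 - α) dy`. -/
noncomputable def renyi (h : ℝ → ℝ) (α : ℝ) {n p : ℕ} (X : Matrix (Fin n) (Fin p) ℝ)
    (θ θ₀ : Param p) : ℝ :=
  1 / (n * (α - 1)) * log (∫ y : Fin n → ℝ, lik h X θ y ^ α * lik h X θ₀ y ^ (1 - α))

/-- The risk of the optimal variational posterior is at most `R` on the data `y`:
for every optimal variational parameter `ξ`, the function `D_α(·, θ₀)` is integrable with respect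
to `π_α(· | 𝒟ₙ, ξ)`, and `(1 - α) ∫_Θ D_α(θ, θ₀) π_α(θ | 𝒟ₙ, ξ) dθ ≤ R`. -/
def RiskAtMost (h : ℝ → ℝ) (α : ℝ) {n p : ℕ} (X : Matrix (Fin n) (Fin p) ℝ)
    (prior : Param p → ℝ) (θ₀ : Param p) (R : ℝ) (y : Fin n → ℝ) : Prop :=
  ∀ ξ : Fin n → ℝ, IsOptimal h α X prior y ξ →
    IntegrableOn (fun θ => renyi h α X θ θ₀ * varPosterior h α X prior y ξ θ) (Theta p) ∧
    (1 - α) * ∫ θ in Theta p, renyi h α X θ θ₀ * varPosterior h α X prior y ξ θ ≤ R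

/-- The property `E` holds with `P`-probability at least `r`. (Stated through a measurable event,
because `E` itself need not be measurable.) -/
def WithProbAtLeast {Ω : Type*} [MeasurableSpace Ω] (P : Measure Ω) (r : ℝ) (E : Ω → Prop) : Prop :=
  ∃ G : Set Ω, MeasurableSet G ∧ ENNReal.ofReal r ≤ P G ∧ ∀ ω ∈ G, E ω

end SSG

/-!
The proof is a change-of-measure argument. For the exact variational posterior the evidence lower
bound is the log-evidence (`profileElbo_eq_log_evidence`), so an optimal `ξ` maximizes the evidence.
Under `ℙ_{θ₀}` the likelihood ratio `(p(y | θ) / p(y | θ₀))^α` has mean `exp (-n (1 - α) D_α(θ, θ₀))`,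
hence its prior integral, weighted by `exp (n (1 - α) D_α)`, has as mean the total prior mass, and by
Markov's inequality it is at most that mass over `ε` with probability `1 - ε`
(`withProbAtLeast_normalizedRatio_le`). Since the tangents minorize the likelihood, on this event
Jensen's inequality bounds `n (1 - α) ∫ D_α dπ_α` for an optimal `ξ` by `log (1 / ε)` plus a constant
plus the logarithm of `p(y | θ₀)^α` over the evidence at any `ξ'` (`risk_le_of_evidence_ge`).

The evidence is bounded below deterministically, by a choice of `ξ'` depending on the data:
`ξ'ᵢ = max |τ₀ (yᵢ - xᵢᵀβ₀)| ρ`, which makes the tangents almost tight at `θ₀`. On the one-sided box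
`‖β - β₀‖_∞ ≤ ρ`, `(1 - ρ) τ₀² ≤ τ² ≤ τ₀²` the tangents lose at most a constant times `ρ` per
observation (`exp_neg_mul_lik_rpow_le_fracTangent`): as `τ ≤ τ₀`, the scaled residual exceeds
`|τ₀ (yᵢ - xᵢᵀβ₀)|` by a bounded multiple of `ρ` only, and `|h'(ξ²)| ≤ K / (2 ξ)` by the Lipschitz
hypothesis. With `ρ` proportional to `ε²` the total loss is `α n ε²`, while the prior mass of the box
is at least of order `ε^(2 (p + 1))`, whose logarithm is of order `p log (1 / ε)`.
-/

namespace SSG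

variable {h : ℝ → ℝ} {n p : ℕ}

/-! ### The likelihood as a probability density -/

lemma TypeI.continuous_sq (hh : TypeI h) : Continuous fun t : ℝ => h (t ^ 2) :=
  hh.lipschitz.choose_spec.continuous

lemma TypeI.integrable_exp (hh : TypeI h) : Integrable fun s : ℝ => exp (h (s ^ 2)) := by
  have hc : Continuous fun s : ℝ => exp (h (s ^ 2)) := continuous_exp.comp hh.continuous_sq
  have h1 : IntegrableOn (fun s : ℝ => exp (h (s ^ 2))) (Icc (-1) 1) :=
    hc.continuousOn.integrableOn_Icc
  have h2 : Integrable fun s : ℝ => |s| ^ 1 * exp (h (s ^ 2)) := hh.moments 1 (by simp)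
  refine (((integrable_indicator_iff measurableSet_Icc).2 h1).add h2).mono'
    hc.aestronglyMeasurable (ae_of_all _ fun s => ?_)
  have he : 0 < exp (h (s ^ 2)) := exp_pos _
  rw [norm_of_nonneg he.le, Pi.add_apply]
  by_cases hs : s ∈ Icc (-1 : ℝ) 1
  · rw [indicator_of_mem hs]
    have : 0 ≤ |s| ^ 1 * exp (h (s ^ 2)) := by positivity
    linarith
  · rw [indicator_of_notMem hs]
    have : 1 ≤ |s| := by
      by_contra! hlt
      exact hs ⟨(abs_lt.1 hlt).1.le, (abs_lt.1 hlt).2.le⟩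
    nlinarith

lemma TypeI.normConst_pos (hh : TypeI h) : 0 < normConst h :=
  integral_exp_pos hh.integrable_exp

/-- Moving the scale inside the square makes the argument of `h` a square also for the irrelevant
parameters with `θ.2 ≤ 0`, where both sides vanish; so only the continuous function `t ↦ h (t ^ 2)`
enters and measurability holds without restricting to `Theta p`. -/
lemma lik1_eq (x : Fin p → ℝ) (θ : Param p) (y : ℝ) :
    lik1 h x θ y = (normConst h)⁻¹ * √θ.2 * exp (h ((√θ.2 * (y - x ⬝ᵥ θ.1)) ^ 2)) := by
  unfold lik1
  rcases le_or_gt θ.2 0 with h0 | h0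
  · simp [sqrt_eq_zero_of_nonpos h0]
  · rw [mul_pow, sq_sqrt h0.le]

lemma lik1_pos (hh : TypeI h) (x : Fin p → ℝ) {θ : Param p} (hθ : θ ∈ Theta p) (y : ℝ) :
    0 < lik1 h x θ y :=
  mul_pos (mul_pos (inv_pos.2 hh.normConst_pos) (sqrt_pos.2 hθ)) (exp_pos _)

lemma lik_pos (hh : TypeI h) (X : Matrix (Fin n) (Fin p) ℝ) {θ : Param p} (hθ : θ ∈ Theta p)
    (y : Fin n → ℝ) : 0 < lik h X θ y :=
  Finset.prod_pos fun i _ => lik1_pos hh (X i) hθ (y i)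

lemma lik_nonneg (hh : TypeI h) (X : Matrix (Fin n) (Fin p) ℝ) (θ : Param p) (y : Fin n → ℝ) :
    0 ≤ lik h X θ y :=
  Finset.prod_nonneg fun _ _ =>
    mul_nonneg (mul_nonneg (inv_nonneg.2 hh.normConst_pos.le) (sqrt_nonneg _)) (exp_pos _).le

lemma measurable_lik (hh : TypeI h) (X : Matrix (Fin n) (Fin p) ℝ) :
    Measurable fun z : Param p × (Fin n → ℝ) => lik h X z.1 z.2 := by
  have hc := hh.continuous_sq
  refine Continuous.measurable ?_
  simp only [lik, lik1_eq]
  refine continuous_finsetProd _ fun i _ => ?_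
  refine Continuous.mul (by fun_prop) (continuous_exp.comp ?_)
  refine hc.comp (f := fun z : Param p × (Fin n → ℝ) => √z.1.2 * (z.2 i - X i ⬝ᵥ z.1.1)) ?_
  simp only [dotProduct]
  fun_prop

lemma measurable_lik_right (hh : TypeI h) (X : Matrix (Fin n) (Fin p) ℝ) (θ : Param p) :
    Measurable (lik h X θ) :=
  (measurable_lik hh X).comp measurable_prodMk_left

lemma integrable_lik1 (hh : TypeI h) (x : Fin p → ℝ) {θ : Param p} (hθ : θ ∈ Theta p) :
    Integrable (lik1 h x θ) := by
  have hne : √θ.2 ≠ 0 := (sqrt_pos.2 hθ).ne'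
  rw [funext (lik1_eq x θ)]
  exact ((hh.integrable_exp.comp_mul_left' hne).comp_sub_right (x ⬝ᵥ θ.1)).const_mul _

lemma integral_lik1 (hh : TypeI h) (x : Fin p → ℝ) {θ : Param p} (hθ : θ ∈ Theta p) :
    ∫ y, lik1 h x θ y = 1 := by
  have h0 : 0 < √θ.2 := sqrt_pos.2 hθ
  have hZ := hh.normConst_pos
  simp_rw [lik1_eq x θ]
  rw [integral_const_mul,
    integral_sub_right_eq_self (fun y => exp (h ((√θ.2 * y) ^ 2))) (x ⬝ᵥ θ.1),
    Measure.integral_comp_mul_left (fun s => exp (h (s ^ 2))) √θ.2]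
  change _ * (_ • normConst h) = 1
  rw [abs_of_pos (inv_pos.2 h0), smul_eq_mul]
  field_simp

lemma integrable_lik (hh : TypeI h) (X : Matrix (Fin n) (Fin p) ℝ) {θ : Param p}
    (hθ : θ ∈ Theta p) : Integrable (lik h X θ) :=
  Integrable.fintype_prod fun i => integrable_lik1 hh (X i) hθ

lemma integral_lik (hh : TypeI h) (X : Matrix (Fin n) (Fin p) ℝ) {θ : Param p}
    (hθ : θ ∈ Theta p) : ∫ y, lik h X θ y = 1 := by
  simp only [lik]
  rw [integral_fintype_prod_volume_eq_prod (fun i => lik1 h (X i) θ)]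
  exact Finset.prod_eq_one fun i _ => integral_lik1 hh (X i) hθ

lemma isProbabilityMeasure_dataLaw (hh : TypeI h) (X : Matrix (Fin n) (Fin p) ℝ) {θ : Param p}
    (hθ : θ ∈ Theta p) : IsProbabilityMeasure (dataLaw h X θ) := by
  refine ⟨?_⟩
  rw [dataLaw, withDensity_apply _ MeasurableSet.univ, setLIntegral_univ,
    ← ofReal_integral_eq_lintegral_ofReal (integrable_lik hh X hθ)
      (ae_of_all _ (lik_nonneg hh X θ)), integral_lik hh X hθ, ENNReal.ofReal_one]

/-! ### The Rényi affinity -/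

/-- The Rényi affinity `∫ p(y | θ)^α p(y | θ₀)^(1 - α) dy`, whose logarithm is
`-n (1 - α) D_α(θ, θ₀)`. -/
noncomputable def affinity (h : ℝ → ℝ) (α : ℝ) (X : Matrix (Fin n) (Fin p) ℝ)
    (θ θ₀ : Param p) : ℝ :=
  ∫ y : Fin n → ℝ, lik h X θ y ^ α * lik h X θ₀ y ^ (1 - α)

section Affinity

variable {α : ℝ} {θ θ₀ : Param p}

lemma one_sub_mul_renyi (X : Matrix (Fin n) (Fin p) ℝ) (hn : 1 ≤ n) (hα : α < 1) :
    (1 - α) * renyi h α X θ θ₀ = (n : ℝ)⁻¹ * log (affinity h α X θ θ₀)⁻¹ := by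
  have h1 : α - 1 ≠ 0 := by linarith
  have h2 : (n : ℝ) ≠ 0 := by positivity
  rw [renyi, affinity, log_inv]
  field_simp
  ring

lemma measurable_affinity (hh : TypeI h) (X : Matrix (Fin n) (Fin p) ℝ) :
    Measurable fun θ => affinity h α X θ θ₀ := by
  have hm : Measurable fun z : Param p × (Fin n → ℝ) =>
      lik h X z.1 z.2 ^ α * lik h X θ₀ z.2 ^ (1 - α) :=
    ((measurable_lik hh X).pow_const α).mul
      (((measurable_lik_right hh X θ₀).comp measurable_snd).pow_const _)
  exact hm.stronglyMeasurable.integral_prod_right'.measurable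

lemma integrable_affinity (hh : TypeI h) (X : Matrix (Fin n) (Fin p) ℝ) (hα : α ∈ Ioo (0 : ℝ) 1)
    (hθ : θ ∈ Theta p) (hθ₀ : θ₀ ∈ Theta p) :
    Integrable fun y => lik h X θ y ^ α * lik h X θ₀ y ^ (1 - α) := by
  refine (((integrable_lik hh X hθ).const_mul α).add
    ((integrable_lik hh X hθ₀).const_mul (1 - α))).mono'
    (((measurable_lik_right hh X θ).pow_const α).mul
      ((measurable_lik_right hh X θ₀).pow_const _)).aestronglyMeasurable (ae_of_all _ fun y => ?_)
  have h1 := lik_nonneg hh X θ y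
  have h2 := lik_nonneg hh X θ₀ y
  rw [norm_of_nonneg (by positivity)]
  exact geom_mean_le_arith_mean2_weighted hα.1.le (by linarith [hα.2]) h1 h2 (by ring)

lemma affinity_pos (hh : TypeI h) (X : Matrix (Fin n) (Fin p) ℝ) (hα : α ∈ Ioo (0 : ℝ) 1)
    (hθ : θ ∈ Theta p) (hθ₀ : θ₀ ∈ Theta p) : 0 < affinity h α X θ θ₀ := by
  have hpos (y) : 0 < lik h X θ y ^ α * lik h X θ₀ y ^ (1 - α) :=
    mul_pos (rpow_pos_of_pos (lik_pos hh X hθ y) _) (rpow_pos_of_pos (lik_pos hh X hθ₀ y) _)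
  refine (integral_pos_iff_support_of_nonneg (fun y => (hpos y).le)
    (integrable_affinity hh X hα hθ hθ₀)).2 ?_
  rw [Function.support_eq_univ fun y => (hpos y).ne']
  exact NeZero.pos _

lemma affinity_le_one (hh : TypeI h) (X : Matrix (Fin n) (Fin p) ℝ) (hα : α ∈ Ioo (0 : ℝ) 1)
    (hθ : θ ∈ Theta p) (hθ₀ : θ₀ ∈ Theta p) : affinity h α X θ θ₀ ≤ 1 := by
  calc affinity h α X θ θ₀ ≤ ∫ y, (α * lik h X θ y + (1 - α) * lik h X θ₀ y) :=
        integral_mono (integrable_affinity hh X hα hθ hθ₀)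
          (((integrable_lik hh X hθ).const_mul α).add
            ((integrable_lik hh X hθ₀).const_mul (1 - α))) fun y =>
          geom_mean_le_arith_mean2_weighted hα.1.le (by linarith [hα.2])
            (lik_nonneg hh X θ y) (lik_nonneg hh X θ₀ y) (by ring)
    _ = 1 := by
        rw [integral_add ((integrable_lik hh X hθ).const_mul α)
          ((integrable_lik hh X hθ₀).const_mul (1 - α)), integral_const_mul, integral_const_mul,
          integral_lik hh X hθ, integral_lik hh X hθ₀]
        ring

end Affinity

/-! ### The high-probability event -/

section Event

variable {α : ℝ} {θ₀ : Param p}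

/-- The prior integral of the likelihood ratio `(p(y | θ) / p(y | θ₀))^α`, normalized by its mean
under `ℙ_{θ₀}`, the Rényi affinity. -/
noncomputable def normalizedRatio (h : ℝ → ℝ) (α : ℝ) (X : Matrix (Fin n) (Fin p) ℝ)
    (prior : Param p → ℝ) (θ₀ : Param p) (y : Fin n → ℝ) : ℝ≥0∞ :=
  ∫⁻ θ in Theta p, ENNReal.ofReal
    (prior θ * (affinity h α X θ θ₀)⁻¹ * (lik h X θ y ^ α * lik h X θ₀ y ^ (-α)))

lemma measurableSet_Theta : MeasurableSet (Theta p) :=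
  measurableSet_lt measurable_const measurable_snd

lemma measurable_normalizedRatio_integrand (hh : TypeI h) (X : Matrix (Fin n) (Fin p) ℝ)
    {prior : Param p → ℝ} (hprior : Measurable prior) :
    Measurable fun z : Param p × (Fin n → ℝ) => ENNReal.ofReal
      (prior z.1 * (affinity h α X z.1 θ₀)⁻¹ *
        (lik h X z.1 z.2 ^ α * lik h X θ₀ z.2 ^ (-α))) := by
  have h1 := (measurable_affinity (α := α) (θ₀ := θ₀) hh X).comp
    (measurable_fst : Measurable (Prod.fst : Param p × (Fin n → ℝ) → _))
  have h2 := (measurable_lik_right hh X θ₀).comp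
    (measurable_snd : Measurable (Prod.snd : Param p × (Fin n → ℝ) → _))
  exact (((hprior.comp measurable_fst).mul h1.inv).mul
    (((measurable_lik hh X).pow_const α).mul (h2.pow_const (-α)))).ennreal_ofReal

lemma measurable_normalizedRatio (hh : TypeI h) (X : Matrix (Fin n) (Fin p) ℝ)
    {prior : Param p → ℝ} (hprior : Measurable prior) :
    Measurable (normalizedRatio h α X prior θ₀) :=
  (measurable_normalizedRatio_integrand hh X hprior).lintegral_prod_left'

lemma lintegral_normalizedRatio (hh : TypeI h) (X : Matrix (Fin n) (Fin p) ℝ)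
    (hα : α ∈ Ioo (0 : ℝ) 1) (hθ₀ : θ₀ ∈ Theta p) {prior : Param p → ℝ}
    (hprior : Measurable prior) (hnonneg : ∀ θ ∈ Theta p, 0 ≤ prior θ) :
    ∫⁻ y, normalizedRatio h α X prior θ₀ y ∂(dataLaw h X θ₀) =
      ∫⁻ θ in Theta p, ENNReal.ofReal (prior θ) := by
  have hl := measurable_lik_right hh X θ₀
  have hm := measurable_normalizedRatio_integrand (α := α) (θ₀ := θ₀) hh X hprior
  rw [dataLaw, lintegral_withDensity_eq_lintegral_mul _ hl.ennreal_ofReal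
    (measurable_normalizedRatio hh X hprior)]
  simp only [Pi.mul_apply, normalizedRatio]
  have hstep (y : Fin n → ℝ) : ENNReal.ofReal (lik h X θ₀ y) * ∫⁻ θ in Theta p, ENNReal.ofReal
        (prior θ * (affinity h α X θ θ₀)⁻¹ * (lik h X θ y ^ α * lik h X θ₀ y ^ (-α))) =
      ∫⁻ θ in Theta p, ENNReal.ofReal (lik h X θ₀ y) * ENNReal.ofReal
        (prior θ * (affinity h α X θ θ₀)⁻¹ * (lik h X θ y ^ α * lik h X θ₀ y ^ (-α))) :=
    (lintegral_const_mul _ (hm.comp measurable_prodMk_right)).symm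
  simp_rw [hstep]
  rw [lintegral_lintegral_swap (by
    exact (((hl.ennreal_ofReal.comp measurable_snd).mul hm).comp measurable_swap).aemeasurable)]
  refine setLIntegral_congr_fun measurableSet_Theta fun θ hθ => ?_
  have hA := affinity_pos hh X hα hθ hθ₀
  have hc : 0 ≤ prior θ * (affinity h α X θ θ₀)⁻¹ := mul_nonneg (hnonneg θ hθ) (inv_pos.2 hA).le
  have hint := integrable_affinity hh X hα hθ hθ₀
  calc ∫⁻ y, ENNReal.ofReal (lik h X θ₀ y) * ENNReal.ofReal
        (prior θ * (affinity h α X θ θ₀)⁻¹ * (lik h X θ y ^ α * lik h X θ₀ y ^ (-α)))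
      = ∫⁻ y, ENNReal.ofReal (prior θ * (affinity h α X θ θ₀)⁻¹) *
          ENNReal.ofReal (lik h X θ y ^ α * lik h X θ₀ y ^ (1 - α)) := by
        refine lintegral_congr fun y => ?_
        have h0 := lik_pos hh X hθ₀ y
        rw [← ENNReal.ofReal_mul h0.le, ← ENNReal.ofReal_mul hc, sub_eq_add_neg, rpow_add h0,
          rpow_one]
        congr 1
        ring
    _ = ENNReal.ofReal (prior θ) := by
        rw [lintegral_const_mul' _ _ ENNReal.ofReal_ne_top,
          ← ofReal_integral_eq_lintegral_ofReal hint (ae_of_all _ fun y => by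
            have h1 := lik_nonneg hh X θ y
            have h2 := lik_nonneg hh X θ₀ y
            positivity), ← ENNReal.ofReal_mul hc]
        change ENNReal.ofReal (_ * affinity h α X θ θ₀) = _
        rw [inv_mul_cancel_right₀ hA.ne']

/-- Markov's inequality for `normalizedRatio`. -/
lemma withProbAtLeast_normalizedRatio_le (hh : TypeI h) (X : Matrix (Fin n) (Fin p) ℝ)
    (hα : α ∈ Ioo (0 : ℝ) 1) (hθ₀ : θ₀ ∈ Theta p) {prior : Param p → ℝ}
    (hprior : Measurable prior) (hnonneg : ∀ θ ∈ Theta p, 0 ≤ prior θ) {M : ℝ} (hM : 0 < M)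
    (hmass : ∫⁻ θ in Theta p, ENNReal.ofReal (prior θ) ≤ ENNReal.ofReal M) {ε : ℝ} (hε : 0 < ε) :
    WithProbAtLeast (dataLaw h X θ₀) (1 - ε)
      fun y => normalizedRatio h α X prior θ₀ y ≤ ENNReal.ofReal (M / ε) := by
  have hm := measurable_normalizedRatio (α := α) (θ₀ := θ₀) hh X hprior
  have := isProbabilityMeasure_dataLaw hh X hθ₀
  have hMε : 0 < M / ε := by positivity
  refine ⟨{y | normalizedRatio h α X prior θ₀ y ≤ ENNReal.ofReal (M / ε)},
    measurableSet_le hm measurable_const, ?_, fun y hy => hy⟩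
  rw [← compl_compl {y | normalizedRatio h α X prior θ₀ y ≤ ENNReal.ofReal (M / ε)},
    prob_compl_eq_one_sub (measurableSet_le hm measurable_const).compl,
    ENNReal.ofReal_sub _ hε.le, ENNReal.ofReal_one]
  refine tsub_le_tsub_left ?_ _
  calc dataLaw h X θ₀ {y | normalizedRatio h α X prior θ₀ y ≤ ENNReal.ofReal (M / ε)}ᶜ
      ≤ dataLaw h X θ₀ {y | ENNReal.ofReal (M / ε) ≤ normalizedRatio h α X prior θ₀ y} :=
        measure_mono fun y hy => by
          rw [mem_compl_iff, mem_ofPred_eq, not_le] at hy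
          exact hy.le
    _ ≤ (∫⁻ y, normalizedRatio h α X prior θ₀ y ∂(dataLaw h X θ₀)) / ENNReal.ofReal (M / ε) :=
        meas_ge_le_lintegral_div hm.aemeasurable (by simpa using hMε) ENNReal.ofReal_ne_top
    _ ≤ ENNReal.ofReal M / ENNReal.ofReal (M / ε) := by
        rw [lintegral_normalizedRatio hh X hα hθ₀ hprior hnonneg]
        gcongr
    _ = ENNReal.ofReal ε := by
        rw [← ENNReal.ofReal_div_of_pos hMε, div_div_cancel₀ hM.ne']

end Event

/-! ### Tangent minorization and the evidence -/

lemma tangentSlope_nonpos (hh : TypeI h) (t : ℝ) : tangentSlope h t ≤ 0 :=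
  hh.decreasing.derivWithin_nonpos

lemma tangent_le (hh : TypeI h) {t : ℝ} (ht : DifferentiableWithinAt ℝ h (Ici 0) (t ^ 2)) {u : ℝ}
    (hu : 0 ≤ u) : tangentSlope h t * u + tangentIntercept h t ≤ h u := by
  have ht2 : t ^ 2 ∈ Ici (0 : ℝ) := sq_nonneg t
  rw [tangentIntercept]
  suffices tangentSlope h t * (u - t ^ 2) ≤ h u - h (t ^ 2) by linarith
  rcases lt_trichotomy (t ^ 2) u with hlt | heq | hgt
  · have := hh.convex.derivWithin_le_slope ht2 hu hlt ht
    rw [slope_def_field, le_div_iff₀ (by linarith)] at this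
    exact this
  · simp [heq]
  · have := hh.convex.slope_le_derivWithin hu ht2 hgt ht
    rw [slope_def_field, div_le_iff₀ (by linarith)] at this
    unfold tangentSlope
    linarith

lemma tangent1_pos (hh : TypeI h) (x : Fin p → ℝ) {θ : Param p} (hθ : θ ∈ Theta p) (ξ y : ℝ) :
    0 < tangent1 h x θ ξ y :=
  mul_pos (mul_pos (inv_pos.2 hh.normConst_pos) (sqrt_pos.2 hθ)) (exp_pos _)

lemma fracTangent_pos (hh : TypeI h) (α : ℝ) (X : Matrix (Fin n) (Fin p) ℝ) {θ : Param p}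
    (hθ : θ ∈ Theta p) (y ξ : Fin n → ℝ) : 0 < fracTangent h α X y ξ θ :=
  rpow_pos_of_pos (Finset.prod_pos fun i _ => tangent1_pos hh (X i) hθ (ξ i) (y i)) _

lemma fracTangent_le_lik_rpow (hh : TypeI h) {α : ℝ} (hα : 0 ≤ α) (X : Matrix (Fin n) (Fin p) ℝ)
    {θ : Param p} (hθ : θ ∈ Theta p) (y : Fin n → ℝ) {ξ : Fin n → ℝ} (hξ : ξ ∈ varParams h n) :
    fracTangent h α X y ξ θ ≤ lik h X θ y ^ α := by
  refine rpow_le_rpow (Finset.prod_nonneg fun i _ => (tangent1_pos hh (X i) hθ _ _).le)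
    (Finset.prod_le_prod (fun i _ => (tangent1_pos hh (X i) hθ _ _).le) fun i _ => ?_) hα
  have hθ' : 0 < θ.2 := hθ
  have hZ := hh.normConst_pos
  unfold tangent1 lik1
  gcongr
  exact tangent_le hh (hξ i).2 (by positivity)

lemma measurable_fracTangent (α : ℝ) (X : Matrix (Fin n) (Fin p) ℝ) (y ξ : Fin n → ℝ) :
    Measurable (fracTangent h α X y ξ) := by
  unfold fracTangent tangent1
  simp only [dotProduct]
  fun_prop

/-- With the exact variational posterior, the evidence lower bound is the log-evidence. -/
lemma profileElbo_eq_log_evidence (hh : TypeI h) {α : ℝ} (X : Matrix (Fin n) (Fin p) ℝ)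
    {prior : Param p → ℝ} (hpos : ∀ θ ∈ Theta p, 0 < prior θ) {y ξ : Fin n → ℝ}
    (hev : evidence h α X prior y ξ ≠ 0) :
    profileElbo h α X prior y ξ = log (evidence h α X prior y ξ) := by
  rw [profileElbo, elbo]
  have hcongr : ∀ θ ∈ Theta p,
      log (fracTangent h α X y ξ θ * prior θ / varPosterior h α X prior y ξ θ) *
        varPosterior h α X prior y ξ θ =
      log (evidence h α X prior y ξ) / evidence h α X prior y ξ *
        (fracTangent h α X y ξ θ * prior θ) := by
    intro θ hθ
    have h1 := (fracTangent_pos hh α X hθ y ξ).ne'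
    have h2 := (hpos θ hθ).ne'
    rw [varPosterior, div_div_cancel₀ (mul_ne_zero h1 h2)]
    ring
  rw [setIntegral_congr_fun measurableSet_Theta hcongr, integral_const_mul]
  exact div_mul_cancel₀ _ hev

lemma evidence_pos (hh : TypeI h) {α : ℝ} (X : Matrix (Fin n) (Fin p) ℝ) {prior : Param p → ℝ}
    (hpos : ∀ θ ∈ Theta p, 0 < prior θ) {y ξ : Fin n → ℝ}
    (hint : IntegrableOn (fun θ => fracTangent h α X y ξ θ * prior θ) (Theta p)) :
    0 < evidence h α X prior y ξ := by
  have hp (θ) (hθ : θ ∈ Theta p) : 0 < fracTangent h α X y ξ θ * prior θ :=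
    mul_pos (fracTangent_pos hh α X hθ y ξ) (hpos θ hθ)
  rw [evidence, setIntegral_pos_iff_support_of_nonneg_ae
    (ae_restrict_of_forall_mem measurableSet_Theta fun θ hθ => (hp θ hθ).le) hint,
    inter_eq_right.2 fun θ hθ => Function.mem_support.2 (hp θ hθ).ne']
  have hopen : IsOpen (Theta p) := isOpen_lt continuous_const continuous_snd
  exact hopen.measure_pos _ ⟨(0, 1), show (0 : ℝ) < 1 from zero_lt_one⟩

/-! ### From the exponential moment to the risk -/

/-- Jensen's inequality for the logarithm under the density `f / ∫ f`, together with the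
integrability of the logarithm. It follows by integrating the tangent bound
`log w ≤ w / E - 1 + log E` at `E = M / ∫ f`. -/
lemma integral_log_mul_div_le {Ω : Type*} [MeasurableSpace Ω] {ν : Measure Ω} {f w : Ω → ℝ} {M : ℝ}
    (hf : Integrable f ν) (hf0 : 0 ≤ᵐ[ν] f) (hpos : 0 < ∫ x, f x ∂ν) (hw : AEMeasurable w ν)
    (hw1 : ∀ᵐ x ∂ν, 1 ≤ w x) (hM : ∫⁻ x, ENNReal.ofReal (f x * w x) ∂ν ≤ ENNReal.ofReal M) :
    Integrable (fun x => log (w x) * (f x / ∫ x, f x ∂ν)) ν ∧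
      ∫ x, log (w x) * (f x / ∫ x, f x ∂ν) ∂ν ≤ log (M / ∫ x, f x ∂ν) := by
  set I := ∫ x, f x ∂ν with hI
  have hfw0 : 0 ≤ᵐ[ν] fun x => f x * w x := by
    filter_upwards [hf0, hw1] with x h1 h2 using mul_nonneg h1 (zero_le_one.trans h2)
  have hfw : Integrable (fun x => f x * w x) ν :=
    ⟨hf.aestronglyMeasurable.mul hw.aestronglyMeasurable, by
      rw [hasFiniteIntegral_iff_ofReal hfw0]
      exact hM.trans_lt ENNReal.ofReal_lt_top⟩
  have hfI : I ≤ ∫ x, f x * w x ∂ν := integral_mono_ae hf hfw (by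
    filter_upwards [hf0, hw1] with x h1 h2 using le_mul_of_one_le_right h1 h2)
  have hM0 : 0 < M := by
    by_contra! hneg
    rw [ENNReal.ofReal_of_nonpos hneg, ← ofReal_integral_eq_lintegral_ofReal hfw hfw0,
      nonpos_iff_eq_zero, ENNReal.ofReal_eq_zero] at hM
    linarith
  have hfwM : ∫ x, f x * w x ∂ν ≤ M := by
    rwa [← ofReal_integral_eq_lintegral_ofReal hfw hfw0, ENNReal.ofReal_le_ofReal_iff hM0.le] at hM
  set E := M / I with hE
  have hE0 : 0 < E := div_pos hM0 hpos
  have hint : Integrable (fun x => log (w x) * (f x / I)) ν := by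
    refine (hfw.div_const I).mono'
      ((measurable_log.comp_aemeasurable hw).aestronglyMeasurable.mul
        (hf.div_const I).aestronglyMeasurable) ?_
    filter_upwards [hf0, hw1] with x h1 h2
    have hl : log (w x) ≤ w x := (log_le_sub_one_of_pos (by linarith)).trans (by linarith)
    have hl0 : 0 ≤ log (w x) := log_nonneg h2
    rw [norm_of_nonneg (mul_nonneg hl0 (div_nonneg h1 hpos.le)), mul_comm, mul_div_right_comm]
    exact mul_le_mul_of_nonneg_left hl (div_nonneg h1 hpos.le)
  refine ⟨hint, ?_⟩
  calc ∫ x, log (w x) * (f x / I) ∂ν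
      ≤ ∫ x, ((E * I)⁻¹ * (f x * w x) + (log E - 1) / I * f x) ∂ν := by
        refine integral_mono_ae hint ((hfw.const_mul _).add (hf.const_mul _)) ?_
        filter_upwards [hf0, hw1] with x h1 h2
        have hl : log (w x) ≤ w x / E - 1 + log E := by
          have := log_le_sub_one_of_pos (div_pos (zero_lt_one.trans_le h2) hE0)
          rw [log_div (by linarith) hE0.ne'] at this
          linarith
        calc log (w x) * (f x / I) ≤ (w x / E - 1 + log E) * (f x / I) :=
              mul_le_mul_of_nonneg_right hl (div_nonneg h1 hpos.le)
          _ = _ := by field_simp; ring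
    _ = (E * I)⁻¹ * (∫ x, f x * w x ∂ν) + (log E - 1) / I * I := by
        rw [integral_add (hfw.const_mul _) (hf.const_mul _), integral_const_mul,
          integral_const_mul]
    _ ≤ (E * I)⁻¹ * M + (log E - 1) / I * I := by
        gcongr
    _ = log E := by
        rw [hE]
        field_simp
        ring

/-- On data with a bounded `normalizedRatio`, the risk of every optimal variational posterior is
controlled by any lower bound for the evidence at a single variational parameter `ξ'`. -/
lemma risk_le_of_evidence_ge (hh : TypeI h) {α : ℝ} (hα : α ∈ Ioo (0 : ℝ) 1) (hn : 1 ≤ n)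
    (X : Matrix (Fin n) (Fin p) ℝ) {θ₀ : Param p} (hθ₀ : θ₀ ∈ Theta p) {prior : Param p → ℝ}
    (hprior : Measurable prior) (hpos : ∀ θ ∈ Theta p, 0 < prior θ) {y : Fin n → ℝ} {M : ℝ}
    (hM : 0 < M) (hy : normalizedRatio h α X prior θ₀ y ≤ ENNReal.ofReal M) {ξ' : Fin n → ℝ}
    (hξ' : ξ' ∈ varParams h n) {c : ℝ} (hc : 0 < c)
    (hev : IntegrableOn (fun θ => fracTangent h α X y ξ' θ * prior θ) (Theta p) →
      c * lik h X θ₀ y ^ α ≤ evidence h α X prior y ξ') :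
    RiskAtMost h α X prior θ₀ ((n : ℝ)⁻¹ * log (M / c)) y := by
  have hl0 := lik_pos hh X hθ₀ y
  have hlα : 0 < lik h X θ₀ y ^ α := rpow_pos_of_pos hl0 _
  have hmom (ξ) (hξ : ξ ∈ varParams h n) : ∫⁻ θ in Theta p, ENNReal.ofReal
      (fracTangent h α X y ξ θ * prior θ * (affinity h α X θ θ₀)⁻¹) ≤
        ENNReal.ofReal (M * lik h X θ₀ y ^ α) := by
    calc ∫⁻ θ in Theta p, ENNReal.ofReal
          (fracTangent h α X y ξ θ * prior θ * (affinity h α X θ θ₀)⁻¹)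
        ≤ ∫⁻ θ in Theta p, ENNReal.ofReal (lik h X θ₀ y ^ α) * ENNReal.ofReal
          (prior θ * (affinity h α X θ θ₀)⁻¹ * (lik h X θ y ^ α * lik h X θ₀ y ^ (-α))) := by
          refine setLIntegral_mono' measurableSet_Theta fun θ hθ => ?_
          have hA := affinity_pos hh X hα hθ hθ₀
          have hπ := hpos θ hθ
          rw [← ENNReal.ofReal_mul hlα.le]
          refine ENNReal.ofReal_le_ofReal ?_
          have hφ := fracTangent_le_lik_rpow hh hα.1.le X hθ y hξ
          calc fracTangent h α X y ξ θ * prior θ * (affinity h α X θ θ₀)⁻¹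
              ≤ lik h X θ y ^ α * prior θ * (affinity h α X θ θ₀)⁻¹ := by gcongr
            _ = _ := by rw [rpow_neg hl0.le]; field_simp
      _ = ENNReal.ofReal (lik h X θ₀ y ^ α) * normalizedRatio h α X prior θ₀ y :=
          lintegral_const_mul' _ _ ENNReal.ofReal_ne_top
      _ ≤ ENNReal.ofReal (lik h X θ₀ y ^ α) * ENNReal.ofReal M := by gcongr
      _ = ENNReal.ofReal (M * lik h X θ₀ y ^ α) := by rw [← ENNReal.ofReal_mul hlα.le, mul_comm]
  have hw1 : ∀ᵐ θ ∂(volume.restrict (Theta p)), 1 ≤ (affinity h α X θ θ₀)⁻¹ :=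
    ae_restrict_of_forall_mem measurableSet_Theta fun θ hθ =>
      (one_le_inv₀ (affinity_pos hh X hα hθ hθ₀)).2 (affinity_le_one hh X hα hθ hθ₀)
  have hf0 (ξ) : 0 ≤ᵐ[volume.restrict (Theta p)] fun θ => fracTangent h α X y ξ θ * prior θ :=
    ae_restrict_of_forall_mem measurableSet_Theta fun θ hθ =>
      (mul_pos (fracTangent_pos hh α X hθ y ξ) (hpos θ hθ)).le
  have hint (ξ) (hξ : ξ ∈ varParams h n) :
      IntegrableOn (fun θ => fracTangent h α X y ξ θ * prior θ) (Theta p) := by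
    refine ⟨((measurable_fracTangent α X y ξ).mul hprior).aestronglyMeasurable, ?_⟩
    rw [hasFiniteIntegral_iff_ofReal (hf0 ξ)]
    refine lt_of_le_of_lt (lintegral_mono_ae ?_) ((hmom ξ hξ).trans_lt ENNReal.ofReal_lt_top)
    filter_upwards [hf0 ξ, hw1] with θ h1 h2
    exact ENNReal.ofReal_le_ofReal (le_mul_of_one_le_right h1 h2)
  have hevpos (ξ) (hξ : ξ ∈ varParams h n) := evidence_pos hh X hpos (hint ξ hξ)
  intro ξ hopt
  have hξ := hopt.1
  have hle : evidence h α X prior y ξ' ≤ evidence h α X prior y ξ := by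
    have := hopt.2 ξ' hξ'
    rwa [profileElbo_eq_log_evidence hh X hpos (hevpos ξ hξ).ne',
      profileElbo_eq_log_evidence hh X hpos (hevpos ξ' hξ').ne',
      log_le_log_iff (hevpos ξ' hξ') (hevpos ξ hξ)] at this
  obtain ⟨hI, hbound⟩ := integral_log_mul_div_le (hint ξ hξ) (hf0 ξ) (hevpos ξ hξ)
    (measurable_affinity hh X).inv.aemeasurable hw1 (hmom ξ hξ)
  change ∫ θ in Theta p, log (affinity h α X θ θ₀)⁻¹ * varPosterior h α X prior y ξ θ ≤
    log (M * lik h X θ₀ y ^ α / evidence h α X prior y ξ) at hbound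
  have hα1 : 1 - α ≠ 0 := by linarith [hα.2]
  have hR : (fun θ => renyi h α X θ θ₀ * varPosterior h α X prior y ξ θ) = fun θ =>
      (1 - α)⁻¹ * (n : ℝ)⁻¹ *
        (log (affinity h α X θ θ₀)⁻¹ * varPosterior h α X prior y ξ θ) := by
    ext θ
    have := one_sub_mul_renyi (h := h) (θ := θ) (θ₀ := θ₀) X hn hα.2
    rw [← mul_assoc, mul_assoc (1 - α)⁻¹, ← this, inv_mul_cancel_left₀ hα1]
  rw [hR, integral_const_mul]
  refine ⟨hI.const_mul _, ?_⟩
  rw [← mul_assoc, ← mul_assoc, mul_inv_cancel₀ hα1, one_mul]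
  refine mul_le_mul_of_nonneg_left (hbound.trans (log_le_log (div_pos (by positivity)
    (hevpos ξ hξ)) ?_)) (by positivity)
  rw [div_le_div_iff₀ (hevpos ξ hξ) hc]
  nlinarith [hev (hint ξ' hξ')]

/-! ### The Normal-Gamma prior -/

section Prior

variable {μ : Fin p → ℝ} {S : Matrix (Fin p) (Fin p) ℝ} {a b : ℝ}

lemma normalGamma_eq (θ : Param p) : normalGamma μ S a b θ =
    (√((2 * π / θ.2) ^ p * S.det))⁻¹ *
      exp (-(θ.2 / 2) * ((θ.1 - μ) ⬝ᵥ (S⁻¹ *ᵥ (θ.1 - μ)))) * gammaPDFReal (a / 2) (b / 2) θ.2 := by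
  rw [normalGamma, det_smul, Fintype.card_fin]

lemma normalGamma_pos (hS : S.PosDef) (ha : 0 < a) (hb : 0 < b) {θ : Param p} (hθ : θ ∈ Theta p) :
    0 < normalGamma μ S a b θ := by
  have hθ' : 0 < θ.2 := hθ
  have hd := hS.det_pos
  rw [normalGamma_eq]
  have := gammaPDFReal_pos (half_pos ha) (half_pos hb) hθ'
  positivity

lemma measurable_normalGamma : Measurable (normalGamma μ S a b) := by
  have hq : Measurable fun θ : Param p => (θ.1 - μ) ⬝ᵥ (S⁻¹ *ᵥ (θ.1 - μ)) := by
    simp only [dotProduct, mulVec]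
    fun_prop
  have hg := (measurable_gammaPDFReal (a / 2) (b / 2)).comp
    (measurable_snd : Measurable (Prod.snd : Param p → ℝ))
  rw [funext normalGamma_eq]
  exact Measurable.mul (by fun_prop) hg

lemma continuousOn_normalGamma (hS : S.PosDef) :
    ContinuousOn (normalGamma μ S a b) (Theta p) := by
  have hd := hS.det_pos
  have hq : Continuous fun θ : Param p => (θ.1 - μ) ⬝ᵥ (S⁻¹ *ᵥ (θ.1 - μ)) := by
    simp only [dotProduct, mulVec]
    fun_prop
  have hne : ∀ θ ∈ Theta p, θ.2 ≠ 0 := fun θ (hθ : 0 < θ.2) => hθ.ne'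
  have hg : ContinuousOn (fun θ : Param p => (b / 2) ^ (a / 2) / Gamma (a / 2) *
      θ.2 ^ (a / 2 - 1) * exp (-(b / 2 * θ.2))) (Theta p) :=
    ContinuousOn.mul (continuousOn_const.mul (continuousOn_snd.rpow_const fun θ hθ =>
      Or.inl (hne θ hθ))) (by fun_prop)
  have hg' : ContinuousOn (fun θ : Param p => gammaPDFReal (a / 2) (b / 2) θ.2) (Theta p) :=
    hg.congr fun θ (hθ : 0 < θ.2) => by simp only [gammaPDFReal, if_pos hθ.le]
  have hc : ContinuousOn (fun θ : Param p => (√((2 * π / θ.2) ^ p * S.det))⁻¹) (Theta p) := by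
    refine ContinuousOn.inv₀ (continuous_sqrt.comp_continuousOn
      (((continuousOn_const.div continuousOn_snd hne).pow p).mul continuousOn_const)) ?_
    intro θ (hθ : 0 < θ.2)
    positivity
  rw [funext normalGamma_eq]
  exact (hc.mul (by fun_prop)).mul hg'

/-- A positive definite quadratic form dominates a multiple of the sum of squares, by compactness
of the unit sphere. -/
lemma PosDef.exists_mul_sum_sq_le {T : Matrix (Fin p) (Fin p) ℝ} (hT : T.PosDef) :
    ∃ c : ℝ, 0 < c ∧ ∀ u : Fin p → ℝ, c * ∑ j, u j ^ 2 ≤ u ⬝ᵥ (T *ᵥ u) := by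
  have hq : Continuous fun u : Fin p → ℝ => u ⬝ᵥ (T *ᵥ u) := by
    simp only [dotProduct, mulVec]
    fun_prop
  obtain ⟨m, hm, hmin⟩ := (isCompact_sphere (0 : Fin p → ℝ) 1).exists_forall_le' (a := 0)
    hq.continuousOn fun u hu => by
      have hu0 : u ≠ 0 := fun h0 => by simp [h0] at hu
      simpa using hT.dotProduct_mulVec_pos hu0
  refine ⟨m / (p + 1), by positivity, fun u => ?_⟩
  rcases eq_or_ne u 0 with rfl | hu
  · simp
  have hu' : 0 < ‖u‖ := norm_pos_iff.2 hu
  have hsum : ∑ j, u j ^ 2 ≤ p * ‖u‖ ^ 2 := by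
    calc ∑ j, u j ^ 2 ≤ ∑ _j : Fin p, ‖u‖ ^ 2 := Finset.sum_le_sum fun j _ => by
          have := norm_le_pi_norm u j
          rw [← norm_of_nonneg (sq_nonneg (u j)), norm_pow]
          gcongr
      _ = p * ‖u‖ ^ 2 := by simp
  have hs := hmin (‖u‖⁻¹ • u) (by simp [norm_smul, hu'.ne'])
  simp only [smul_dotProduct, dotProduct_smul, mulVec_smul, smul_eq_mul] at hs
  have hs' : m * ‖u‖ ^ 2 ≤ u ⬝ᵥ (T *ᵥ u) := by
    have := mul_le_mul_of_nonneg_right hs (sq_nonneg ‖u‖)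
    field_simp at this
    linarith
  refine le_trans ?_ hs'
  rw [div_mul_eq_mul_div, div_le_iff₀ (by positivity)]
  nlinarith [mul_le_mul_of_nonneg_left hsum hm.le, mul_pos hm (pow_pos hu' 2)]

lemma integrable_gammaPDFReal {r s : ℝ} (hr : 0 < r) (hs : 0 < s) :
    Integrable (gammaPDFReal r s) := by
  refine ⟨(measurable_gammaPDFReal r s).aestronglyMeasurable, ?_⟩
  rw [hasFiniteIntegral_iff_ofReal (ae_of_all _ (gammaPDFReal_nonneg hr hs))]
  have := lintegral_gammaPDF_eq_one hr hs
  simp only [gammaPDF] at this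
  simp [this]

/-- Given `τ²`, a product of centred Gaussians of variance of order `1 / τ²`, normalized up to a
constant, dominates the conditional density of `β`; its integral does not depend on `τ²`. -/
lemma integrableOn_normalGamma (hS : S.PosDef) (ha : 0 < a) (hb : 0 < b) :
    IntegrableOn (normalGamma μ S a b) (Theta p) := by
  obtain ⟨c, hc, hquad⟩ := PosDef.exists_mul_sum_sq_le hS.inv
  have hd := hS.det_pos
  set g : ℝ → ℝ → ℝ := fun t u => √t * exp (-(t / 2 * c) * u ^ 2) with hg
  set G : Param p → ℝ := fun θ =>
    (∏ j, g θ.2 (θ.1 j - μ j)) * gammaPDFReal (a / 2) (b / 2) θ.2 with hG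
  have hTheta : (volume.restrict (Theta p) : Measure (Param p)) =
      (volume : Measure (Fin p → ℝ)).prod (volume.restrict (Ioi 0)) := by
    have : Theta p = univ ×ˢ Ioi 0 := by ext θ; simp [Theta]
    rw [this, Measure.volume_eq_prod, ← Measure.prod_restrict, Measure.restrict_univ]
  have hGm : Measurable G := by
    have := (measurable_gammaPDFReal (a / 2) (b / 2)).comp
      (measurable_snd : Measurable (Prod.snd : Param p → ℝ))
    refine Measurable.mul ?_ this
    simp only [hg]
    fun_prop
  have hG0 (θ : Param p) : 0 ≤ G θ :=
    mul_nonneg (Finset.prod_nonneg fun j _ => by simp only [hg]; positivity)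
      (gammaPDFReal_nonneg (half_pos ha) (half_pos hb) _)
  have hgint (t : ℝ) (ht : 0 < t) (m : ℝ) : Integrable fun u => g t (u - m) :=
    ((integrable_exp_neg_mul_sq (b := t / 2 * c) (by positivity)).const_mul √t).comp_sub_right m
  have hgval (t : ℝ) (ht : 0 < t) (m : ℝ) : ∫ u, g t (u - m) = √(2 * π / c) := by
    rw [integral_sub_right_eq_self (g t) m, integral_const_mul, integral_gaussian, ← sqrt_mul ht.le]
    congr 1
    field_simp
  have hGint : IntegrableOn G (Theta p) := by
    rw [IntegrableOn, hTheta, integrable_prod_iff' hGm.aestronglyMeasurable]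
    constructor
    · refine ae_restrict_of_forall_mem measurableSet_Ioi fun t ht => ?_
      have hprod : Integrable fun β : Fin p → ℝ => ∏ j, g t (β j - μ j) :=
        Integrable.fintype_prod fun j => hgint t ht (μ j)
      exact hprod.mul_const (gammaPDFReal (a / 2) (b / 2) t)
    · have hval : ∀ t ∈ Ioi (0 : ℝ), √(2 * π / c) ^ p * gammaPDFReal (a / 2) (b / 2) t =
          ∫ β : Fin p → ℝ, ‖G (β, t)‖ := by
        intro t ht
        simp_rw [norm_of_nonneg (hG0 _)]
        simp only [hG]
        rw [integral_mul_const,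
          integral_fintype_prod_volume_eq_prod (fun j u => g t (u - μ j))]
        simp [hgval t ht]
      exact IntegrableOn.congr_fun (((integrable_gammaPDFReal (half_pos ha)
        (half_pos hb)).const_mul _).integrableOn) hval measurableSet_Ioi
  refine (hGint.const_mul (√(2 * π) ^ p * √S.det)⁻¹).mono'
    measurable_normalGamma.aestronglyMeasurable
    (ae_restrict_of_forall_mem measurableSet_Theta fun θ hθ => ?_)
  have hθ' : 0 < θ.2 := hθ
  rw [norm_of_nonneg (normalGamma_pos hS ha hb hθ).le, normalGamma_eq]
  have hprod : ∏ j, g θ.2 (θ.1 j - μ j) =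
      √θ.2 ^ p * exp (-(θ.2 / 2) * (c * ∑ j, (θ.1 - μ) j ^ 2)) := by
    simp only [hg]
    rw [Finset.prod_mul_distrib, ← exp_sum, ← Finset.mul_sum]
    simp [mul_assoc]
  have hpow : √((2 * π / θ.2) ^ p) = √(2 * π) ^ p / √θ.2 ^ p := by
    rw [← div_pow, ← sqrt_div (by positivity)]
    rw [sqrt_eq_iff_mul_self_eq (by positivity) (by positivity), ← mul_pow,
      mul_self_sqrt (by positivity)]
  have hgam := gammaPDFReal_nonneg (half_pos ha) (half_pos hb) θ.2
  have hτ : 0 < √θ.2 := sqrt_pos.2 hθ'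
  rw [sqrt_mul (by positivity), hpow]
  simp only [hG]
  rw [hprod]
  calc (√(2 * π) ^ p / √θ.2 ^ p * √S.det)⁻¹ *
        exp (-(θ.2 / 2) * ((θ.1 - μ) ⬝ᵥ (S⁻¹ *ᵥ (θ.1 - μ)))) * gammaPDFReal (a / 2) (b / 2) θ.2
      ≤ (√(2 * π) ^ p / √θ.2 ^ p * √S.det)⁻¹ *
        exp (-(θ.2 / 2) * (c * ∑ j, (θ.1 - μ) j ^ 2)) * gammaPDFReal (a / 2) (b / 2) θ.2 := by
        have := mul_le_mul_of_nonneg_left (hquad (θ.1 - μ)) (half_pos hθ').le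
        gcongr ?_ * exp ?_ * ?_
        · linarith
    _ = _ := by field_simp

/-- The box `‖β - β₀‖_∞ ≤ ρ`, `(1 - ρ) τ₀² ≤ τ² ≤ τ₀²`. Only scales `τ ≤ τ₀` are admitted: then the
residuals of a parameter in the box exceed those of `θ₀` by at most a constant, however large they
are. -/
def box (θ₀ : Param p) (ρ : ℝ) : Set (Param p) :=
  Icc (fun j => θ₀.1 j - ρ) (fun j => θ₀.1 j + ρ) ×ˢ Icc (θ₀.2 * (1 - ρ)) θ₀.2

lemma measurableSet_box (θ₀ : Param p) (ρ : ℝ) : MeasurableSet (box θ₀ ρ) :=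
  measurableSet_Icc.prod measurableSet_Icc

lemma box_subset_Theta {θ₀ : Param p} (hθ₀ : θ₀ ∈ Theta p) {ρ : ℝ} (hρ : ρ < 1) :
    box θ₀ ρ ⊆ Theta p := fun _ hθ =>
  lt_of_lt_of_le (mul_pos hθ₀ (by linarith)) hθ.2.1

lemma box_mono {θ₀ : Param p} (hθ₀ : θ₀ ∈ Theta p) {ρ ρ' : ℝ} (hρ : ρ ≤ ρ') :
    box θ₀ ρ ⊆ box θ₀ ρ' := by
  have : 0 < θ₀.2 := hθ₀
  exact prod_mono (Icc_subset_Icc (fun j => by dsimp; linarith) (fun j => by dsimp; linarith))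
    (Icc_subset_Icc (by gcongr) le_rfl)

lemma volume_real_box {θ₀ : Param p} (hθ₀ : θ₀ ∈ Theta p) {ρ : ℝ} (hρ : 0 ≤ ρ) :
    volume.real (box θ₀ ρ) = (2 * ρ) ^ p * (θ₀.2 * ρ) := by
  have h0 : 0 < θ₀.2 := hθ₀
  rw [box, Measure.volume_eq_prod, measureReal_prod_prod, Measure.real, Measure.real,
    Real.volume_Icc_pi_toReal (fun j => by dsimp; linarith), Real.volume_Icc,
    ENNReal.toReal_ofReal (by nlinarith)]
  congr 1
  · simp [two_mul]
  · ring

/-- The prior mass of `box θ₀ ρ` is at least of the order `ρ ^ (p + 1)` of its volume. -/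
lemma exists_mul_pow_le_integral_box (hS : S.PosDef) (ha : 0 < a) (hb : 0 < b) {θ₀ : Param p}
    (hθ₀ : θ₀ ∈ Theta p) : ∃ c : ℝ, 0 < c ∧ ∀ ρ ∈ Ioc (0 : ℝ) (1 / 2),
      c * ρ ^ (p + 1) ≤ ∫ θ in box θ₀ ρ, normalGamma μ S a b θ := by
  have hsub : box θ₀ (1 / 2) ⊆ Theta p := box_subset_Theta hθ₀ (by norm_num)
  have h0 : 0 < θ₀.2 := hθ₀
  obtain ⟨m, hm, hmin⟩ := (isCompact_Icc.prod isCompact_Icc :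
    IsCompact (box θ₀ (1 / 2))).exists_forall_le' (a := 0)
    ((continuousOn_normalGamma (μ := μ) (a := a) (b := b) hS).mono hsub)
    fun θ hθ => normalGamma_pos hS ha hb (hsub hθ)
  refine ⟨m * (2 ^ p * θ₀.2), by positivity, fun ρ hρ => ?_⟩
  have hsub' := box_mono hθ₀ hρ.2
  calc m * (2 ^ p * θ₀.2) * ρ ^ (p + 1) = m * volume.real (box θ₀ ρ) := by
        rw [volume_real_box hθ₀ hρ.1.le]
        ring
    _ ≤ ∫ θ in box θ₀ ρ, normalGamma μ S a b θ :=
        setIntegral_ge_of_const_le_real (measurableSet_box θ₀ ρ)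
          (isCompact_Icc.prod isCompact_Icc : IsCompact (box θ₀ ρ)).measure_lt_top.ne
          (fun θ hθ => hmin θ (hsub' hθ))
          ((integrableOn_normalGamma hS ha hb).mono_set (hsub'.trans hsub))

end Prior

/-! ### Tightness of the tangents near the true parameter -/

lemma TypeI.differentiableAt (hh : TypeI h) {t : ℝ} (ht : 0 < t) : DifferentiableAt ℝ h t :=
  (hh.smooth.contDiffAt (Ioi_mem_nhds ht)).differentiableAt (by norm_num)

/-- The Lipschitz bound on `t ↦ h (t ^ 2)` bounds `A(t) = h'(t ^ 2)`, which may blow up at `0`. -/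
lemma neg_le_tangentSlope (hh : TypeI h) {K : ℝ≥0} (hK : LipschitzWith K fun t : ℝ => h (t ^ 2))
    {t : ℝ} (ht : 0 < t) : -(K / (2 * t)) ≤ tangentSlope h t := by
  have hd := hh.differentiableAt (pow_pos ht 2)
  have hslope : tangentSlope h t = deriv h (t ^ 2) :=
    hd.derivWithin (uniqueDiffOn_Ici 0 _ (sq_nonneg t))
  have hcomp : HasDerivAt (fun t : ℝ => h (t ^ 2)) (deriv h (t ^ 2) * (2 * t)) t := by
    have := HasDerivAt.comp t (h₂ := h) (h := fun t : ℝ => t ^ 2) hd.hasDerivAt (hasDerivAt_pow 2 t)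
    simpa [Function.comp_def] using this
  have hle := norm_deriv_le_of_lipschitz hK (x₀ := t)
  rw [hcomp.deriv, ← hslope, norm_eq_abs] at hle
  have := (abs_le.1 hle).1
  rw [neg_le, ← neg_le_neg_iff, neg_neg, ← neg_div, div_le_iff₀ (by positivity)]
  exact this

/-- The tangent to `h` at `ξ ^ 2`, where `ξ` is `|s|` truncated below at `η`, evaluated at a square
`v ^ 2` with `|v| ≤ |s| + d`, loses at most a constant against `h (s ^ 2)`. Truncating keeps `ξ` away
from `0`, where the tangent may not exist. -/
lemma sub_le_tangent (hh : TypeI h) {K : ℝ≥0} (hK : LipschitzWith K fun t : ℝ => h (t ^ 2))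
    {s v d η : ℝ} (hη : 0 < η) (hd : 0 ≤ d) (hv : |v| ≤ |s| + d) :
    h (s ^ 2) - (K * η + K * d + K * d ^ 2 / (2 * η)) ≤
      tangentSlope h (max |s| η) * v ^ 2 + tangentIntercept h (max |s| η) := by
  set ξ := max |s| η with hξ
  have hsξ : |s| ≤ ξ := le_max_left _ _
  have hηξ : η ≤ ξ := le_max_right _ _
  have hξ0 : 0 < ξ := hη.trans_le hηξ
  have hξs : ξ ≤ |s| + η := max_le (by linarith) (by linarith [abs_nonneg s])
  have hK0 : (0 : ℝ) ≤ K := K.2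
  have h1 : h (s ^ 2) - h (ξ ^ 2) ≤ K * η := by
    have hl := hK.dist_le_mul |s| ξ
    simp only [dist_eq, sq_abs] at hl
    refine (le_abs_self _).trans (hl.trans (mul_le_mul_of_nonneg_left ?_ hK0))
    rw [abs_sub_comm, abs_of_nonneg (by linarith)]
    linarith
  have h2 : v ^ 2 - ξ ^ 2 ≤ 2 * ξ * d + d ^ 2 := by
    have : v ^ 2 ≤ (ξ + d) ^ 2 := by
      rw [← sq_abs v]
      gcongr
      linarith
    linarith
  have hA := tangentSlope_nonpos hh ξ
  have hA' := neg_le_tangentSlope hh hK hξ0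
  have h3 : -(K * d + K * d ^ 2 / (2 * η)) ≤ tangentSlope h ξ * (v ^ 2 - ξ ^ 2) := by
    calc -(K * d + K * d ^ 2 / (2 * η)) ≤ -(K * d + K * d ^ 2 / (2 * ξ)) := by gcongr
      _ = -(K / (2 * ξ)) * (2 * ξ * d + d ^ 2) := by field_simp
      _ ≤ tangentSlope h ξ * (2 * ξ * d + d ^ 2) := by gcongr
      _ ≤ tangentSlope h ξ * (v ^ 2 - ξ ^ 2) := mul_le_mul_of_nonpos_left h2 hA
  rw [tangentIntercept]
  linarith

lemma exp_neg_two_mul_le_one_sub {ρ : ℝ} (hρ : ρ ∈ Icc (0 : ℝ) (1 / 2)) :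
    exp (-(2 * ρ)) ≤ 1 - ρ := by
  rw [exp_neg]
  refine inv_le_of_inv_le₀ (by linarith [hρ.2]) ?_
  have := add_one_le_exp (2 * ρ)
  refine le_trans ?_ this
  rw [inv_le_iff_one_le_mul₀ (by linarith [hρ.2])]
  nlinarith [hρ.1, hρ.2]

lemma abs_dotProduct_le_of_abs_le {x u : Fin p → ℝ} {B ρ : ℝ} (hx : √(x ⬝ᵥ x) ≤ B)
    (hu : ∀ j, |u j| ≤ ρ) : |x ⬝ᵥ u| ≤ p * |B| * ρ := by
  have hxj (j) : |x j| ≤ |B| := by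
    rw [← sqrt_sq_eq_abs]
    refine le_trans (sqrt_le_sqrt ?_) (hx.trans (le_abs_self B))
    rw [sq]
    exact Finset.single_le_sum (f := fun j => x j * x j) (fun j _ => mul_self_nonneg _)
      (Finset.mem_univ j)
  calc |x ⬝ᵥ u| ≤ ∑ j, |x j * u j| := Finset.abs_sum_le_sum_abs _ _
    _ ≤ ∑ _j : Fin p, |B| * ρ := Finset.sum_le_sum fun j _ => by
        rw [abs_mul]
        exact mul_le_mul (hxj j) (hu j) (abs_nonneg _) (abs_nonneg _)
    _ = p * |B| * ρ := by simp [mul_assoc]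

/-- The loss per observation and per unit of `ρ` of the tangents on `box θ₀ ρ`. -/
noncomputable def tangentLoss (K τ₀ R : ℝ) : ℝ := 1 + K + K * (τ₀ * R) + K * (τ₀ * R) ^ 2 / 2

lemma exp_neg_mul_lik1_le_tangent1 (hh : TypeI h) {K : ℝ≥0}
    (hK : LipschitzWith K fun t : ℝ => h (t ^ 2)) {θ₀ : Param p} (hθ₀ : θ₀ ∈ Theta p) {B ρ : ℝ}
    (hρ : ρ ∈ Ioc (0 : ℝ) (1 / 2)) {x : Fin p → ℝ} (hx : √(x ⬝ᵥ x) ≤ B) {θ : Param p}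
    (hθ : θ ∈ box θ₀ ρ) (y : ℝ) :
    exp (-(tangentLoss K √θ₀.2 (p * |B|) * ρ)) * lik1 h x θ₀ y ≤
      tangent1 h x θ (max |√θ₀.2 * (y - x ⬝ᵥ θ₀.1)| ρ) y := by
  have hZ := hh.normConst_pos
  have hθ₀' : 0 < θ₀.2 := hθ₀
  have hθ' : 0 < θ.2 := box_subset_Theta hθ₀ (by linarith [hρ.2]) hθ
  set T := √θ₀.2 with hT
  set d := T * (p * |B|) * ρ with hd
  have hd0 : 0 ≤ d := mul_nonneg (mul_nonneg (sqrt_nonneg _) (by positivity)) hρ.1.le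
  have hτ : √θ.2 ≤ T := sqrt_le_sqrt hθ.2.2
  have hτ' : exp (-ρ) * T ≤ √θ.2 := by
    refine le_sqrt_of_sq_le ?_
    rw [mul_pow, hT, sq_sqrt hθ₀'.le, ← exp_nat_mul]
    have := exp_neg_two_mul_le_one_sub ⟨hρ.1.le, hρ.2⟩
    push_cast
    rw [mul_neg]
    nlinarith [hθ.2.1]
  have hδ : |x ⬝ᵥ (θ.1 - θ₀.1)| ≤ p * |B| * ρ := by
    refine abs_dotProduct_le_of_abs_le hx fun j => abs_le.2 ⟨?_, ?_⟩
    · have := hθ.1.1 j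
      simp only [Pi.sub_apply]
      linarith
    · have := hθ.1.2 j
      simp only [Pi.sub_apply]
      linarith
  have hv : |√θ.2 * (y - x ⬝ᵥ θ.1)| ≤ |T * (y - x ⬝ᵥ θ₀.1)| + d := by
    have hsplit : y - x ⬝ᵥ θ.1 = (y - x ⬝ᵥ θ₀.1) - x ⬝ᵥ (θ.1 - θ₀.1) := by
      rw [dotProduct_sub]
      ring
    calc |√θ.2 * (y - x ⬝ᵥ θ.1)| = √θ.2 * |y - x ⬝ᵥ θ.1| := by
          rw [abs_mul, abs_of_nonneg (sqrt_nonneg _)]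
      _ ≤ T * (|y - x ⬝ᵥ θ₀.1| + p * |B| * ρ) := by
          rw [hsplit]
          exact mul_le_mul hτ ((abs_sub _ _).trans (by gcongr)) (abs_nonneg _) (sqrt_nonneg _)
      _ = |T * (y - x ⬝ᵥ θ₀.1)| + d := by
          rw [abs_mul, abs_of_nonneg (sqrt_nonneg _), hd]
          ring
  have hmain := sub_le_tangent hh hK hρ.1 hd0 hv
  have hloss : -(tangentLoss K T (p * |B|) * ρ) =
      -ρ - (K * ρ + K * d + K * d ^ 2 / (2 * ρ)) := by
    have := hρ.1.ne'
    rw [tangentLoss, hd]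
    field_simp
    ring
  rw [mul_pow √θ.2, sq_sqrt hθ'.le] at hmain
  rw [lik1_eq, tangent1, hloss, ← hT]
  calc exp (-ρ - (K * ρ + K * d + K * d ^ 2 / (2 * ρ))) *
        ((normConst h)⁻¹ * T * exp (h ((T * (y - x ⬝ᵥ θ₀.1)) ^ 2)))
      = (normConst h)⁻¹ * (exp (-ρ) * T) *
        exp (h ((T * (y - x ⬝ᵥ θ₀.1)) ^ 2) - (K * ρ + K * d + K * d ^ 2 / (2 * ρ))) := by
        rw [exp_sub, exp_sub]
        ring
    _ ≤ _ := by gcongr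

lemma exp_neg_mul_lik_rpow_le_fracTangent (hh : TypeI h) {K : ℝ≥0}
    (hK : LipschitzWith K fun t : ℝ => h (t ^ 2)) {α : ℝ} (hα : 0 ≤ α) {θ₀ : Param p}
    (hθ₀ : θ₀ ∈ Theta p) {B ρ : ℝ} (hρ : ρ ∈ Ioc (0 : ℝ) (1 / 2)) {X : Matrix (Fin n) (Fin p) ℝ}
    (hX : ∀ i, √(X i ⬝ᵥ X i) ≤ B) {θ : Param p} (hθ : θ ∈ box θ₀ ρ) (y : Fin n → ℝ) :
    exp (-(α * n * (tangentLoss K √θ₀.2 (p * |B|) * ρ))) * lik h X θ₀ y ^ α ≤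
      fracTangent h α X y (fun i => max |√θ₀.2 * (y i - X i ⬝ᵥ θ₀.1)| ρ) θ := by
  have hprod : exp (-(n * (tangentLoss K √θ₀.2 (p * |B|) * ρ))) * lik h X θ₀ y ≤
      ∏ i, tangent1 h (X i) θ (max |√θ₀.2 * (y i - X i ⬝ᵥ θ₀.1)| ρ) (y i) := by
    calc exp (-(n * (tangentLoss K √θ₀.2 (p * |B|) * ρ))) * lik h X θ₀ y
        = ∏ i, exp (-(tangentLoss K √θ₀.2 (p * |B|) * ρ)) * lik1 h (X i) θ₀ (y i) := by
          rw [Finset.prod_mul_distrib, lik, Finset.prod_const, Finset.card_univ, Fintype.card_fin,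
            ← exp_nat_mul, mul_neg]
      _ ≤ _ := Finset.prod_le_prod
          (fun i _ => mul_nonneg (exp_pos _).le (lik1_pos hh _ hθ₀ _).le)
          fun i _ => exp_neg_mul_lik1_le_tangent1 hh hK hθ₀ hρ (hX i) hθ (y i)
  have hl := lik_nonneg hh X θ₀ y
  calc exp (-(α * n * (tangentLoss K √θ₀.2 (p * |B|) * ρ))) * lik h X θ₀ y ^ α
      = (exp (-(n * (tangentLoss K √θ₀.2 (p * |B|) * ρ))) * lik h X θ₀ y) ^ α := by
        rw [mul_rpow (exp_pos _).le hl, ← exp_mul]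
        congr 2
        ring
    _ ≤ _ := rpow_le_rpow (by positivity) hprod hα

/-! ### The risk bound -/

lemma riskAtMost_mono {α : ℝ} {X : Matrix (Fin n) (Fin p) ℝ} {prior : Param p → ℝ} {θ₀ : Param p}
    {R R' : ℝ} (hR : R ≤ R') {y : Fin n → ℝ} (hy : RiskAtMost h α X prior θ₀ R y) :
    RiskAtMost h α X prior θ₀ R' y :=
  fun ξ hξ => ⟨(hy ξ hξ).1, (hy ξ hξ).2.trans hR⟩

lemma WithProbAtLeast.mono {Ω : Type*} [MeasurableSpace Ω] {P : Measure Ω} {r r' : ℝ}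
    {E E' : Ω → Prop} (hE : WithProbAtLeast P r E) (hr : r' ≤ r) (hEE' : ∀ ω, E ω → E' ω) :
    WithProbAtLeast P r' E' := by
  obtain ⟨G, hG, hPG, hGE⟩ := hE
  exact ⟨G, hG, (ENNReal.ofReal_le_ofReal hr).trans hPG, fun ω hω => hEE' ω (hGE ω hω)⟩

/-- The risk bound with the radius `ρ = ε² / L` of the box, where `L` is the loss per observation
and per unit of `ρ`, so that the tangents lose at most `ε²` per observation. -/
lemma exists_withProbAtLeast_risk_le (hh : TypeI h) {μ : Fin p → ℝ} {S : Matrix (Fin p) (Fin p) ℝ}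
    (hS : S.PosDef) {a b : ℝ} (ha : 0 < a) (hb : 0 < b) {θ₀ : Param p} (hθ₀ : θ₀ ∈ Theta p)
    (B : ℝ) : ∃ C : ℝ, ∀ (n : ℕ) (X : Matrix (Fin n) (Fin p) ℝ), 1 ≤ n →
      (∀ i, √(X i ⬝ᵥ X i) ≤ B) → ∀ ε ∈ Ioo (0 : ℝ) (1 / 4), ∀ α ∈ Ioo (0 : ℝ) 1,
        WithProbAtLeast (dataLaw h X θ₀) (1 - ε) (RiskAtMost h α X (normalGamma μ S a b) θ₀
          (α * ε ^ 2 + (n : ℝ)⁻¹ * (C + (2 * p + 3) * log (1 / ε)))) := by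
  obtain ⟨K, hK⟩ := hh.lipschitz
  obtain ⟨c, hc, hbox⟩ := exists_mul_pow_le_integral_box (μ := μ) hS ha hb hθ₀
  set L := tangentLoss K √θ₀.2 (p * |B|) with hL
  have hL1 : 1 ≤ L := by
    have : (0 : ℝ) ≤ K := K.2
    have : 0 ≤ (K : ℝ) + K * (√θ₀.2 * (p * |B|)) + K * (√θ₀.2 * (p * |B|)) ^ 2 / 2 := by positivity
    rw [hL, tangentLoss]
    linarith
  have hint := integrableOn_normalGamma (μ := μ) hS ha hb
  have hpos : ∀ θ ∈ Theta p, 0 < normalGamma μ S a b θ := fun θ hθ => normalGamma_pos hS ha hb hθ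
  have hpos' : 0 ≤ᵐ[volume.restrict (Theta p)] normalGamma μ S a b :=
    ae_restrict_of_forall_mem measurableSet_Theta fun θ hθ => (hpos θ hθ).le
  -- Only the finiteness of the prior mass matters; adding `1` makes the positivity of `M` immediate.
  set M := (∫ θ in Theta p, normalGamma μ S a b θ) + 1 with hM
  have hM0 : 0 < M := by
    have := integral_nonneg_of_ae hpos'
    linarith
  have hmass : ∫⁻ θ in Theta p, ENNReal.ofReal (normalGamma μ S a b θ) ≤ ENNReal.ofReal M := by
    rw [← ofReal_integral_eq_lintegral_ofReal hint hpos']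
    exact ENNReal.ofReal_le_ofReal (by linarith)
  refine ⟨log (M / c) + (p + 1) * log L, fun n X hn hX ε hε α hα => ?_⟩
  refine (withProbAtLeast_normalizedRatio_le hh X hα hθ₀ measurable_normalGamma
    (fun θ hθ => (hpos θ hθ).le) hM0 hmass hε.1).mono le_rfl fun y hy => ?_
  have hε0 := hε.1
  set ρ := ε ^ 2 / L with hρdef
  have hρ : ρ ∈ Ioc (0 : ℝ) (1 / 2) := by
    refine ⟨by positivity, ?_⟩
    rw [hρdef, div_le_iff₀ (by linarith)]
    nlinarith [hε.2]
  have hLρ : L * ρ = ε ^ 2 := mul_div_cancel₀ _ (by positivity)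
  set ξ' : Fin n → ℝ := fun i => max |√θ₀.2 * (y i - X i ⬝ᵥ θ₀.1)| ρ with hξ'def
  have hξ' : ξ' ∈ varParams h n := fun i => by
    have h0 : 0 < ξ' i := lt_max_of_lt_right hρ.1
    exact ⟨h0.le, (hh.differentiableAt (pow_pos h0 2)).differentiableWithinAt⟩
  have hrisk := risk_le_of_evidence_ge hh hα hn X hθ₀ measurable_normalGamma hpos
    (div_pos hM0 hε0) hy hξ' (c := exp (-(α * n * ε ^ 2)) * (c * ρ ^ (p + 1)))
    (mul_pos (exp_pos _) (mul_pos hc (pow_pos hρ.1 _))) fun hi => by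
      have hsub : box θ₀ ρ ⊆ Theta p := box_subset_Theta hθ₀ (by linarith [hρ.2])
      have hl := lik_nonneg hh X θ₀ y
      calc exp (-(α * n * ε ^ 2)) * (c * ρ ^ (p + 1)) * lik h X θ₀ y ^ α
          ≤ exp (-(α * n * ε ^ 2)) * (∫ θ in box θ₀ ρ, normalGamma μ S a b θ) *
            lik h X θ₀ y ^ α := by
            gcongr
            exact hbox ρ hρ
        _ = ∫ θ in box θ₀ ρ,
            exp (-(α * n * (L * ρ))) * lik h X θ₀ y ^ α * normalGamma μ S a b θ := by
            rw [integral_const_mul, hLρ]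
            ring
        _ ≤ ∫ θ in box θ₀ ρ, fracTangent h α X y ξ' θ * normalGamma μ S a b θ :=
            setIntegral_mono_on ((hint.mono_set hsub).const_mul _) (hi.mono_set hsub)
              (measurableSet_box θ₀ ρ) fun θ hθ => mul_le_mul_of_nonneg_right
                (exp_neg_mul_lik_rpow_le_fracTangent hh hK hα.1.le hθ₀ hρ hX hθ y)
                (hpos θ (hsub hθ)).le
        _ ≤ evidence h α X (normalGamma μ S a b) y ξ' :=
            setIntegral_mono_set hi (ae_restrict_of_forall_mem measurableSet_Theta fun θ hθ =>
              (mul_pos (fracTangent_pos hh α X hθ y ξ') (hpos θ hθ)).le) hsub.eventuallyLE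
  refine riskAtMost_mono (le_of_eq ?_) hrisk
  have hn' : (n : ℝ) ≠ 0 := by positivity
  have hL0 : L ≠ 0 := by positivity
  have hρ0 := hρ.1.ne'
  rw [log_div (by positivity) (by positivity), log_div hM0.ne' hε0.ne',
    log_mul (exp_ne_zero _) (by positivity), log_exp, log_mul hc.ne' (by positivity), log_pow,
    hρdef, log_div (by positivity) hL0, log_pow, log_div hM0.ne' hc.ne', one_div, log_inv]
  field_simp
  push_cast
  ring

/-- Under `c₁ p log n / n ≤ ε²`, the logarithm of `1 / ε` is at most of order `log n`. -/
lemma log_one_div_le_mul_log {c₁ ε : ℝ} (hc₁ : 0 < c₁) (hp : 1 ≤ p) (hn : 2 ≤ n)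
    (hle : c₁ * (p * log n / n) ≤ ε ^ 2) :
    log (1 / ε) ≤ (1 + |log (c₁ * log 2)| / log 2) * log n := by
  have hn' : (2 : ℝ) ≤ n := by exact_mod_cast hn
  have hp' : (1 : ℝ) ≤ p := by exact_mod_cast hp
  have hl2 : 0 < log 2 := log_pos (by norm_num)
  have hln : log 2 ≤ log n := log_le_log (by norm_num) hn'
  have h1 : c₁ * log 2 / n ≤ ε ^ 2 := by
    refine le_trans ?_ hle
    rw [mul_div_assoc]
    gcongr
    nlinarith
  have h2 : log (c₁ * log 2 / n) ≤ 2 * log ε := by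
    have := log_le_log (by positivity) h1
    rwa [log_pow, Nat.cast_ofNat] at this
  rw [log_div (by positivity) (by positivity)] at h2
  have h3 : |log (c₁ * log 2)| ≤ |log (c₁ * log 2)| / log 2 * log n := by
    rw [div_mul_eq_mul_div, le_div_iff₀ hl2]
    gcongr
  have h4 := neg_abs_le (log (c₁ * log 2))
  have h5 := abs_nonneg (log (c₁ * log 2))
  rw [one_div, log_inv]
  linarith

end SSG

theorem theorem3 {p : ℕ} (hp : 1 ≤ p) (h : ℝ → ℝ) (hh : SSG.TypeI h)
    (μ : Fin p → ℝ) (S : Matrix (Fin p) (Fin p) ℝ) (hS : S.PosDef)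
    (a b : ℝ) (ha : 0 < a) (hb : 0 < b)
    (θ₀ : SSG.Param p) (hθ₀ : θ₀ ∈ SSG.Theta p) (B : ℝ) :
    ∃ C₁ : ℝ, 0 < C₁ ∧
      (∀ (n : ℕ) (X : Matrix (Fin n) (Fin p) ℝ), 1 ≤ n → (∀ i, √(X i ⬝ᵥ X i) ≤ B) →
        ∀ ε ∈ Ioo (0 : ℝ) (1 / 4), ∀ α ∈ Ioo (0 : ℝ) 1, ∀ D : ℝ, 1 < D →
          SSG.WithProbAtLeast (SSG.dataLaw h X θ₀) (1 - 4 * ε - ((D - 1) ^ 2 * n * ε ^ 2)⁻¹)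
            (SSG.RiskAtMost h α X (SSG.normalGamma μ S a b) θ₀
              (D * α * ε ^ 2 + p * log p / n + C₁ * (p / n) * log (1 / ε)))) ∧
      (∀ c₁ c₂ D : ℝ, 0 < c₁ → 0 < c₂ → 1 < D → ∃ C₂ : ℝ, 0 < C₂ ∧
        ∀ (n : ℕ) (X : Matrix (Fin n) (Fin p) ℝ), 2 ≤ n → (∀ i, √(X i ⬝ᵥ X i) ≤ B) →
          ∀ ε ∈ Ioo (0 : ℝ) (1 / 4), ∀ α ∈ Ioo (0 : ℝ) 1,
            c₁ * (p * log n / n) ≤ ε ^ 2 → ε ^ 2 ≤ c₂ * (p * log n / n) →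
              SSG.WithProbAtLeast (SSG.dataLaw h X θ₀) (1 - 4 * ε - ((D - 1) ^ 2 * n * ε ^ 2)⁻¹)
                (SSG.RiskAtMost h α X (SSG.normalGamma μ S a b) θ₀ (C₂ * (p * log n / n)))) := by
  obtain ⟨C, hC⟩ := SSG.exists_withProbAtLeast_risk_le (μ := μ) hh hS ha hb hθ₀ B
  have hp' : (1 : ℝ) ≤ p := by exact_mod_cast hp
  set C₁ : ℝ := |C| + 5 with hC₁
  have hC₁0 : 0 < C₁ := by positivity
  have hbound : ∀ (n : ℕ) (X : Matrix (Fin n) (Fin p) ℝ), 1 ≤ n → (∀ i, √(X i ⬝ᵥ X i) ≤ B) →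
      ∀ ε ∈ Ioo (0 : ℝ) (1 / 4), ∀ α ∈ Ioo (0 : ℝ) 1, ∀ D : ℝ, 1 < D →
        SSG.WithProbAtLeast (SSG.dataLaw h X θ₀) (1 - 4 * ε - ((D - 1) ^ 2 * n * ε ^ 2)⁻¹)
          (SSG.RiskAtMost h α X (SSG.normalGamma μ S a b) θ₀
            (D * α * ε ^ 2 + p * log p / n + C₁ * (p / n) * log (1 / ε))) := by
    intro n X hn hX ε hε α hα D hD
    have hε0 := hε.1
    have hn' : (0 : ℝ) < n := by exact_mod_cast hn
    refine (hC n X hn hX ε hε α hα).mono ?_ fun y => SSG.riskAtMost_mono ?_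
    · have : 0 ≤ ((D - 1) ^ 2 * n * ε ^ 2)⁻¹ := by positivity
      linarith
    · -- Since `ε < 1 / 4`, `log (1 / ε) ≥ 1`, so the constant `C` is of order `p log (1 / ε)`.
      have hl1 : 1 ≤ log (1 / ε) := by
        rw [le_log_iff_exp_le (by positivity)]
        refine exp_one_lt_d9.le.trans ?_
        rw [le_div_iff₀ hε0]
        linarith [hε.2]
      have h1 : α * ε ^ 2 ≤ D * α * ε ^ 2 := by
        have : 0 ≤ α * ε ^ 2 := mul_nonneg hα.1.le (sq_nonneg ε)
        nlinarith
      have h2 : 0 ≤ p * log p / n := by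
        have := log_nonneg hp'
        positivity
      have h3 : C + (2 * p + 3) * log (1 / ε) ≤ C₁ * p * log (1 / ε) := by
        have hpl : 1 ≤ p * log (1 / ε) := one_le_mul_of_one_le_of_one_le hp' hl1
        have hCp : C ≤ |C| * (p * log (1 / ε)) :=
          (le_abs_self C).trans (le_mul_of_one_le_right (abs_nonneg C) hpl)
        have h5 : (2 * p + 3) * log (1 / ε) ≤ 5 * p * log (1 / ε) := by
          gcongr
          linarith
        rw [hC₁]
        linarith
      have h4 : (n : ℝ)⁻¹ * (C + (2 * p + 3) * log (1 / ε)) ≤ C₁ * (p / n) * log (1 / ε) := by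
        calc (n : ℝ)⁻¹ * (C + (2 * p + 3) * log (1 / ε)) ≤ (n : ℝ)⁻¹ * (C₁ * p * log (1 / ε)) := by
              gcongr
          _ = _ := by ring
      linarith
  refine ⟨C₁, hC₁0, hbound, fun c₁ c₂ D hc₁ hc₂ hD => ?_⟩
  have hl2 : 0 < log 2 := log_pos (by norm_num)
  have hlp : 0 ≤ log p := log_nonneg hp'
  refine ⟨D * c₂ + log p / log 2 + C₁ * (1 + |log (c₁ * log 2)| / log 2), by positivity,
    fun n X hn hX ε hε α hα hlow hup => ?_⟩
  refine (hbound n X (by omega) hX ε hε α hα D hD).mono le_rfl fun y => SSG.riskAtMost_mono ?_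
  have hn' : (2 : ℝ) ≤ n := by exact_mod_cast hn
  have hln : log 2 ≤ log n := log_le_log (by norm_num) hn'
  have h1 : D * α * ε ^ 2 ≤ D * c₂ * (p * log n / n) := by
    calc D * α * ε ^ 2 ≤ D * 1 * ε ^ 2 := by
          gcongr
          exact hα.2.le
      _ ≤ D * 1 * (c₂ * (p * log n / n)) := by gcongr
      _ = _ := by ring
  have h2 : p * log p / n ≤ log p / log 2 * (p * log n / n) := by
    calc p * log p / n = log p / log 2 * (p * log 2 / n) := by field_simp
      _ ≤ _ := by gcongr
  have h3 : C₁ * (p / n) * log (1 / ε) ≤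
      C₁ * (1 + |log (c₁ * log 2)| / log 2) * (p * log n / n) := by
    calc C₁ * (p / n) * log (1 / ε)
        ≤ C₁ * (p / n) * ((1 + |log (c₁ * log 2)| / log 2) * log n) := by
          gcongr
          exact SSG.log_one_div_le_mul_log hc₁ hp hn hlow
      _ = _ := by ring
  linarith
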